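/- **Setting.** For $\kappa\in(0,1)$, the (type 2) Mittag-Leffler law $ML(\kappa)$ is the probability law on $(0,\infty)$ with moment generating function $E(e^{sU})=\sum_{m\ge 0}\frac{s^m}{\Gamma(\kappa m+1)}$, $s\in\mathbb R$. The law $\mathrm{NML}(\kappa)$ is the law of $\sqrt U\,Z$ with $U\sim ML(\kappa)$ and $Z\sim N(0,1)$ independent, and for $\mu\in\mathbb R$, $\sigma>0$, $\mathrm{NML}(\mu,\sigma^2,\kappa)$ is the law of $\sigma Y+\mu$ with $Y\sim\mathrm{NML}(\kappa)$. Let $h:(0,1]\to\mathbb R$, $h(\kappa)=\Gamma(\kappa+1)^2/\Gamma(2\kappa+1)$, let $\Psi=\Gamma'/\Gamma$, and put $$\omega(x,y,z)=\frac{z-6x^2y+5x^4}{6(y-x^2)^2},\qquad g(x,y,z)=\Big(x,\ (y-x^2)\,\Gamma\big(h^{-1}(\omega)+1\big),\ h^{-1}(\omega)\Big).$$ Let $Y_1,Y_2,\dots$ be i.i.d. with law $\mathrm{NML}(\mu,\sigma^2,\kappa)$, where $\mu\in\mathbb R$, $\sigma>0$, $\kappa\in(0,1)$; let $\mu_k=E(Y_1^k)$,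 $M_k=\frac1n\sum_{i=1}^nY_i^k$, and let the method-of-moments estimators be $(\widehat\mu,\widehat\sigma^2,\widehat\kappa)=g(M_1,M_2,M_4)$ (with $h^{-1}$ given an arbitrary constant value outside the range of $h$). **Proposition.** (a) $h$ is continuous and strictly decreasing on $(0,1]$, hence has an inverse $h^{-1}$ on its range. If $x^2<y$ and $\omega(x,y,z)\in h((0,1])$, then $g(x,y,z)$ is the unique $(m,s,k)$ with $s>0$, $k\in(0,1]$ and $$m=x,\qquad \frac{s}{\Gamma(k+1)}+m^2=y,\qquad \frac{6s^2}{\Gamma(2k+1)}+\frac{6m^2s}{\Gamma(k+1)}+m^4=z.$$ All moments of $Y_1$ are finite, and $(m,s,k)=(\mu,\sigma^2,\kappa)$ satisfies this system for $(x,y,z)=(\mu_1,\mu_2,\mu_4)$. Almost surely, for all large $n$, $M_1^2<M_2$ and $\omega(M_1,M_2,M_4)\in h((0,1])$. (b) $\widehat\mu\to\mu$, $\widehat\sigma^2\to\sigma^2$ and $\widehat\kappa\to\kappa$ almost surely as $n\to\infty$. (c) As $n\to\infty$, $$\sqrt n\,\{(\widehat\mu,\widehat\sigma^2,\widehat\kappa)-(\mu,\sigma^2,\kappa)\}\overset{d}{\longrightarrow}N_3(0,\nabla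 g\,\Sigma\,\nabla g^\top),$$ with $\nabla g$ evaluated at $(\mu_1,\mu_2,\mu_4)$ and $\nabla g\,\Sigma\,\nabla g^\top$ positive semidefinite. Here $\Sigma$ is the covariance matrix of $(Y_1,Y_1^2,Y_1^4)$, and it is given by $$\Sigma_{11}=\tfrac{\sigma^2}{\Gamma(\kappa+1)},\quad \Sigma_{12}=\Sigma_{21}=\tfrac{2\mu\sigma^2}{\Gamma(\kappa+1)},\quad \Sigma_{13}=\Sigma_{31}=\tfrac{24\mu\sigma^4}{\Gamma(2\kappa+1)}+\tfrac{4\mu^3\sigma^2}{\Gamma(\kappa+1)},$$ $$\Sigma_{22}=\tfrac{6\sigma^4}{\Gamma(2\kappa+1)}+\tfrac{4\mu^2\sigma^2}{\Gamma(\kappa+1)}-\tfrac{\sigma^4}{\Gamma(\kappa+1)^2},$$ $$\Sigma_{23}=\Sigma_{32}=\tfrac{90\sigma^6}{\Gamma(3\kappa+1)}-\tfrac{6\sigma^6}{\Gamma(2\kappa+1)\Gamma(\kappa+1)}+\tfrac{84\mu^2\sigma^4}{\Gamma(2\kappa+1)}-\tfrac{6\mu^2\sigma^4}{\Gamma(\kappa+1)^2}+\tfrac{8\mu^4\sigma^2}{\Gamma(\kappa+1)},$$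 $$\Sigma_{33}=\tfrac{16\mu^6\sigma^2}{\Gamma(\kappa+1)}+\tfrac{408\mu^4\sigma^4}{\Gamma(2\kappa+1)}-\tfrac{36\mu^4\sigma^4}{\Gamma(\kappa+1)^2}-\tfrac{72\mu^2\sigma^6}{\Gamma(\kappa+1)\Gamma(2\kappa+1)}+\tfrac{2520\mu^2\sigma^6}{\Gamma(3\kappa+1)}+\tfrac{2520\sigma^8}{\Gamma(4\kappa+1)}-\tfrac{36\sigma^8}{\Gamma(2\kappa+1)^2}.$$ At every $(x,y,z)$ with $y\ne x^2$ and $\omega=\omega(x,y,z)\in h((0,1))$, $g$ is differentiable with Jacobian matrix $$\nabla g=\begin{pmatrix}1&0&0\\ -2x\Gamma(k+1)+(y-x^2)\Gamma'(k+1)\,d_x&\Gamma(k+1)+(y-x^2)\Gamma'(k+1)\,d_y&(y-x^2)\Gamma'(k+1)\,d_z\\ d_x&d_y&d_z\end{pmatrix},$$ where $k=h^{-1}(\omega)$, $\Gamma'(k+1)=\Gamma(k+1)\Psi(k+1)$, $h'(k)=\frac{2\Gamma(k+1)^2[\Psi(k+1)-\Psi(2k+1)]}{\Gamma(2k+1)}$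 and $$d_x=\frac{4x^3y-6xy^2+2xz}{3h'(k)(y-x^2)^3},\qquad d_y=\frac{-2x^4+3x^2y-z}{3h'(k)(y-x^2)^3},\qquad d_z=\frac{1}{6h'(k)(y-x^2)^2}.$$ -/

import Mathlib

open MeasureTheory ProbabilityTheory Filter Topology

namespace NML

noncomputable section

/-- The Mittag-Leffler function `E_κ(z) = ∑ z ^ m / Γ(κ m + 1)` at real arguments. -/
def mittagLeffler (κ z : ℝ) : ℝ :=
  ∑' m : ℕ, z ^ m / Real.Gamma (κ * m + 1)

/-- `ν` is the (type 2) Mittag-Leffler law `ML(κ)`: the probability law on `(0, ∞)` whose moment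
generating function is finite on the whole real line and equal to the Mittag-Leffler function. -/
structure IsMittagLefflerLaw (κ : ℝ) (ν : Measure ℝ) : Prop where
  isProbabilityMeasure : IsProbabilityMeasure ν
  measure_Iic_zero : ν (Set.Iic 0) = 0
  integrable_exp : ∀ s : ℝ, Integrable (fun u => Real.exp (s * u)) ν
  mgf_eq : ∀ s : ℝ, mgf id ν s = mittagLeffler κ s

/-- `ρ` is the standard law `NML(κ)`: the law of `√U * Z` with `U ∼ ML(κ)` and `Z ∼ N(0, 1)`
independent. -/
def IsStdNMLLaw (κ : ℝ) (ρ : Measure ℝ) : Prop :=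
  ∃ ν : Measure ℝ, IsMittagLefflerLaw κ ν ∧
    ρ = (ν.prod (gaussianReal 0 1)).map (fun p : ℝ × ℝ => √p.1 * p.2)

/-- `ρ` is the law `NML(μ, σ², κ)`: the law of `σ * Y + μ` with `Y ∼ NML(κ)`. -/
def IsNMLLaw (μ σ κ : ℝ) (ρ : Measure ℝ) : Prop :=
  ∃ ρ₀ : Measure ℝ, IsStdNMLLaw κ ρ₀ ∧ ρ = ρ₀.map (fun y => σ * y + μ)

/-- The function `h(κ) = Γ(κ + 1)² / Γ(2κ + 1)`; its domain of interest is `(0, 1]`. -/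
def h (κ : ℝ) : ℝ :=
  Real.Gamma (κ + 1) ^ 2 / Real.Gamma (2 * κ + 1)

/-- The inverse of `h : (0, 1] → ℝ`. Outside the range `h '' (0, 1]` the value is an unspecified
constant. -/
def hInv (w : ℝ) : ℝ :=
  Function.invFunOn h (Set.Ioc 0 1) w

/-- The ratio `ω = (z - 6x²y + 5x⁴) / (6 (y - x²)²)`. -/
def ratio (x y z : ℝ) : ℝ :=
  (z - 6 * x ^ 2 * y + 5 * x ^ 4) / (6 * (y - x ^ 2) ^ 2)

/-- The map `g : ℝ³ → ℝ³` that turns the moments of order 1, 2, 4 into the parameters. -/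
def g (v : EuclideanSpace ℝ (Fin 3)) : EuclideanSpace ℝ (Fin 3) :=
  !₂[v 0,
    (v 1 - v 0 ^ 2) * Real.Gamma (hInv (ratio (v 0) (v 1) (v 2)) + 1),
    hInv (ratio (v 0) (v 1) (v 2))]

/-- The real digamma function `Ψ = Γ' / Γ`. -/
def digamma (x : ℝ) : ℝ :=
  deriv Real.Gamma x / Real.Gamma x

/-- The closed form of `h'(κ)`. -/
def hDeriv (κ : ℝ) : ℝ :=
  2 * Real.Gamma (κ + 1) ^ 2 * (digamma (κ + 1) - digamma (2 * κ + 1)) / Real.Gamma (2 * κ + 1)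

/-- The closed form of `∂/∂x h⁻¹(ω)`. -/
def dxInv (x y z : ℝ) : ℝ :=
  1 / hDeriv (hInv (ratio x y z)) *
    ((4 * x ^ 3 * y - 6 * x * y ^ 2 + 2 * x * z) / (3 * (y - x ^ 2) ^ 3))

/-- The closed form of `∂/∂y h⁻¹(ω)`. -/
def dyInv (x y z : ℝ) : ℝ :=
  1 / hDeriv (hInv (ratio x y z)) *
    ((-2 * x ^ 4 + 3 * x ^ 2 * y - z) / (3 * (y - x ^ 2) ^ 3))

/-- The closed form of `∂/∂z h⁻¹(ω)`. -/
def dzInv (x y z : ℝ) : ℝ :=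
  1 / (hDeriv (hInv (ratio x y z)) * (6 * (y - x ^ 2) ^ 2))

/-- `Γ'(h⁻¹(ω) + 1) = Γ(h⁻¹(ω) + 1) Ψ(h⁻¹(ω) + 1)`. -/
def gammaDerivInv (x y z : ℝ) : ℝ :=
  Real.Gamma (hInv (ratio x y z) + 1) * digamma (hInv (ratio x y z) + 1)

/-- The closed form of the Jacobian matrix `∇g(x, y, z)`. -/
def gradG (x y z : ℝ) : Matrix (Fin 3) (Fin 3) ℝ :=
  !![1, 0, 0;
    -2 * x * Real.Gamma (hInv (ratio x y z) + 1)
        + (y - x ^ 2) * gammaDerivInv x y z * dxInv x y z,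
      Real.Gamma (hInv (ratio x y z) + 1)
        + (y - x ^ 2) * gammaDerivInv x y z * dyInv x y z,
      (y - x ^ 2) * gammaDerivInv x y z * dzInv x y z;
    dxInv x y z, dyInv x y z, dzInv x y z]

/-- The matrix `Σ`, in closed form. -/
def covMatrix (μ σ κ : ℝ) : Matrix (Fin 3) (Fin 3) ℝ :=
  let G₁ := Real.Gamma (κ + 1)
  let G₂ := Real.Gamma (2 * κ + 1)
  let G₃ := Real.Gamma (3 * κ + 1)
  let G₄ := Real.Gamma (4 * κ + 1)
  let s₁₁ := σ ^ 2 / G₁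
  let s₁₂ := 2 * μ * σ ^ 2 / G₁
  let s₁₃ := 24 * μ * σ ^ 4 / G₂ + 4 * μ ^ 3 * σ ^ 2 / G₁
  let s₂₂ := 6 * σ ^ 4 / G₂ + 4 * μ ^ 2 * σ ^ 2 / G₁ - σ ^ 4 / G₁ ^ 2
  let s₂₃ := 90 * σ ^ 6 / G₃ - 6 * σ ^ 6 / (G₂ * G₁) + 84 * μ ^ 2 * σ ^ 4 / G₂
    - 6 * μ ^ 2 * σ ^ 4 / G₁ ^ 2 + 8 * μ ^ 4 * σ ^ 2 / G₁
  let s₃₃ := 16 * μ ^ 6 * σ ^ 2 / G₁ + 408 * μ ^ 4 * σ ^ 4 / G₂ - 36 * μ ^ 4 * σ ^ 4 / G₁ ^ 2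
    - 72 * μ ^ 2 * σ ^ 6 / (G₁ * G₂) + 2520 * μ ^ 2 * σ ^ 6 / G₃ + 2520 * σ ^ 8 / G₄
    - 36 * σ ^ 8 / G₂ ^ 2
  !![s₁₁, s₁₂, s₁₃; s₁₂, s₂₂, s₂₃; s₁₃, s₂₃, s₃₃]

/-- The population moment of order `k` of the law `ρ`. -/
def popMoment (ρ : Measure ℝ) (k : ℕ) : ℝ :=
  ∫ x, x ^ k ∂ρ

/-- The matrix `∇g Σ ∇gᵀ`, with `∇g` taken at the population moments of order 1, 2, 4 of `ρ`. -/
def asympCov (μ σ κ : ℝ) (ρ : Measure ℝ) : Matrix (Fin 3) (Fin 3) ℝ :=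
  gradG (popMoment ρ 1) (popMoment ρ 2) (popMoment ρ 4) * covMatrix μ σ κ *
    (gradG (popMoment ρ 1) (popMoment ρ 2) (popMoment ρ 4)).transpose

/-- The sample moment `M_k = (1/n) ∑ yᵢ ^ k` of the first `n` terms of `y`. -/
def sampleMoment (y : ℕ → ℝ) (n k : ℕ) : ℝ :=
  (1 / (n : ℝ)) * ∑ i ∈ Finset.range n, y i ^ k

/-- The ratio of sample moments at which `h⁻¹` is evaluated. -/
def sampleRatio (y : ℕ → ℝ) (n : ℕ) : ℝ :=
  ratio (sampleMoment y n 1) (sampleMoment y n 2) (sampleMoment y n 4)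

/-- The estimator of `μ`. -/
def muHat (y : ℕ → ℝ) (n : ℕ) : ℝ :=
  sampleMoment y n 1

/-- The estimator of `κ`. -/
def kappaHat (y : ℕ → ℝ) (n : ℕ) : ℝ :=
  hInv (sampleRatio y n)

/-- The estimator of `σ²`. -/
def sigmaSqHat (y : ℕ → ℝ) (n : ℕ) : ℝ :=
  (sampleMoment y n 2 - sampleMoment y n 1 ^ 2) * Real.Gamma (hInv (sampleRatio y n) + 1)

/-- The method-of-moments system: `(m, s, k)` is a parameter `(μ, σ², κ)` with `σ² > 0` and
`κ ∈ (0, 1]`, whose moments of order 1, 2, 4 are `x, y, z`. -/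
def SolvesSystem (x y z m s k : ℝ) : Prop :=
  0 < s ∧ k ∈ Set.Ioc (0 : ℝ) 1 ∧
    m = x ∧
    s / Real.Gamma (k + 1) + m ^ 2 = y ∧
    6 * s ^ 2 / Real.Gamma (2 * k + 1) + 6 * m ^ 2 * s / Real.Gamma (k + 1) + m ^ 4 = z

end

end NML

namespace NML

/-! The system is solved by centring. Subtracting the mean contributions gives `y - x² = s / Γ(k+1)`
and `z - 6x²y + 5x⁴ = 6s² / Γ(2k+1)`, so `ω = h(k)` depends on `k` alone. The logarithmic derivative
of `h` is `2(Ψ(k+1) - Ψ(2k+1))`, negative because `Ψ` is strictly increasing. So `k` is recovered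
from `ω`, then `s` from the variance (`solvesSystem_iff`), and `g` is differentiable where `k` is
interior (`hasFDerivAt_g`).

The moments of the Mittag-Leffler law are the Taylor coefficients of its moment generating function.
With the Gaussian moments and the binomial theorem they give every population moment that the system
and `Σ` require.

Consistency is the strong law for `(Y, Y², Y⁴)` plus continuity of `g` at the population moments.
Asymptotic normality is the multivariate central limit theorem, obtained from the scalar one by
projecting on each direction, followed by the delta method for `g`. -/

/-! ### Digamma, the function `h` and its inverse -/

lemma differentiableAt_Gamma_of_pos {x : ℝ} (hx : 0 < x) : DifferentiableAt ℝ Real.Gamma x :=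
  Real.differentiableAt_Gamma fun m => by
    have : (0 : ℝ) ≤ m := m.cast_nonneg
    linarith

lemma hasDerivAt_Gamma_of_pos {x : ℝ} (hx : 0 < x) :
    HasDerivAt Real.Gamma (Real.Gamma x * digamma x) x := by
  have hne := (Real.Gamma_pos_of_pos hx).ne'
  have := (differentiableAt_Gamma_of_pos hx).hasDerivAt
  refine this.congr_deriv ?_
  unfold digamma
  field_simp

lemma hasDerivAt_log_Gamma {x : ℝ} (hx : 0 < x) :
    HasDerivAt (Real.log ∘ Real.Gamma) (digamma x) x := by
  have hne := (Real.Gamma_pos_of_pos hx).ne'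
  simpa [digamma, Function.comp_def] using
    ((differentiableAt_Gamma_of_pos hx).hasDerivAt).log hne

lemma digamma_add_one {x : ℝ} (hx : 0 < x) : digamma (x + 1) = digamma x + 1 / x := by
  have h1 : HasDerivAt (fun y => (Real.log ∘ Real.Gamma) (y + 1)) (digamma (x + 1)) x := by
    simpa using (hasDerivAt_log_Gamma (x := x + 1) (by linarith)).comp_add_const x 1
  have h2 : HasDerivAt (fun y => (Real.log ∘ Real.Gamma) y + Real.log y) (digamma x + 1 / x) x := by
    rw [one_div]
    exact (hasDerivAt_log_Gamma hx).add (Real.hasDerivAt_log hx.ne')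
  refine h1.unique (h2.congr_of_eventuallyEq ?_)
  filter_upwards [lt_mem_nhds hx] with y hy
  simp only [Function.comp_apply]
  rw [Real.Gamma_add_one hy.ne', Real.log_mul hy.ne' (Real.Gamma_pos_of_pos hy).ne', add_comm]

lemma monotoneOn_digamma : MonotoneOn digamma (Set.Ioi 0) := by
  have hm := Real.convexOn_log_Gamma.monotoneOn_deriv
    fun x hx => (hasDerivAt_log_Gamma hx).differentiableAt
  intro x hx y hy hxy
  simpa [(hasDerivAt_log_Gamma hx).deriv, (hasDerivAt_log_Gamma hy).deriv] using hm hx hy hxy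

/-- Log-convexity of `Γ` only gives weak monotonicity. The functional equation upgrades it: if `Ψ(x)
= Ψ(y)` with `x < y`, then `Ψ(x+1) - Ψ(y+1) = 1/x - 1/y > 0`, against monotonicity at `x+1 < y+1`.
-/
lemma strictMonoOn_digamma : StrictMonoOn digamma (Set.Ioi 0) := by
  intro x hx y hy hxy
  have hx' : 0 < x := hx
  have hy' : 0 < y := hy
  refine lt_of_le_of_ne (monotoneOn_digamma hx hy hxy.le) fun heq => ?_
  have h1 := monotoneOn_digamma (show x + 1 ∈ Set.Ioi (0 : ℝ) from add_pos hx' one_pos)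
    (show y + 1 ∈ Set.Ioi (0 : ℝ) from add_pos hy' one_pos) (by linarith)
  rw [digamma_add_one hx', digamma_add_one hy'] at h1
  have := one_div_lt_one_div_of_lt hx' hxy
  linarith

lemma hasDerivAt_h {k : ℝ} (hk : 0 < k) : HasDerivAt h (hDeriv k) k := by
  have h1 : HasDerivAt (fun κ => Real.Gamma (κ + 1)) _ k :=
    (hasDerivAt_Gamma_of_pos (x := k + 1) (by linarith)).comp_add_const k 1
  have h2 : HasDerivAt (fun κ : ℝ => Real.Gamma (2 * κ + 1))
      (Real.Gamma (2 * k + 1) * digamma (2 * k + 1) * 2) k := by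
    have : HasDerivAt (fun κ : ℝ => 2 * κ + 1) 2 k := by
      simpa using ((hasDerivAt_id k).const_mul 2).add_const 1
    exact (hasDerivAt_Gamma_of_pos (x := 2 * k + 1) (by linarith)).comp k this
  have hne : Real.Gamma (2 * k + 1) ≠ 0 := (Real.Gamma_pos_of_pos (by linarith)).ne'
  refine ((h1.pow 2).div h2 hne).congr_deriv ?_
  unfold hDeriv
  simp only [Pi.pow_apply]
  field_simp
  ring

lemma hDeriv_neg {k : ℝ} (hk : 0 < k) : hDeriv k < 0 := by
  unfold hDeriv
  have h1 := Real.Gamma_pos_of_pos (s := k + 1) (by linarith)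
  have h2 := Real.Gamma_pos_of_pos (s := 2 * k + 1) (by linarith)
  have h3 := strictMonoOn_digamma (show k + 1 ∈ Set.Ioi (0 : ℝ) from by simp; linarith)
    (show 2 * k + 1 ∈ Set.Ioi (0 : ℝ) from by simp; linarith) (by linarith)
  refine div_neg_of_neg_of_pos (mul_neg_of_pos_of_neg (by positivity) (by linarith)) h2

lemma continuousOn_h : ContinuousOn h (Set.Ioi 0) :=
  fun _ hk => (hasDerivAt_h hk).continuousAt.continuousWithinAt

lemma strictAntiOn_h : StrictAntiOn h (Set.Ioi 0) := by
  refine strictAntiOn_of_deriv_neg (convex_Ioi 0) continuousOn_h fun k hk => ?_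
  rw [interior_Ioi] at hk
  rw [(hasDerivAt_h hk).deriv]
  exact hDeriv_neg hk

lemma strictAntiOn_h_Ioc : StrictAntiOn h (Set.Ioc 0 1) :=
  strictAntiOn_h.mono Set.Ioc_subset_Ioi_self

lemma hInv_h {k : ℝ} (hk : k ∈ Set.Ioc (0 : ℝ) 1) : hInv (h k) = k :=
  strictAntiOn_h_Ioc.injOn.leftInvOn_invFunOn hk

lemma h_hInv {w : ℝ} (hw : w ∈ h '' Set.Ioc 0 1) : h (hInv w) = w :=
  Function.invFunOn_eq hw

lemma hInv_mem {w : ℝ} (hw : w ∈ h '' Set.Ioc 0 1) : hInv w ∈ Set.Ioc (0 : ℝ) 1 :=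
  Function.invFunOn_mem hw

/-- Interior points only: `h 1` is the least value of `h` on `(0, 1]`, so the range is not a
neighbourhood of it. -/
lemma image_h_Ioo_mem_nhds {k : ℝ} (hk : k ∈ Set.Ioo (0 : ℝ) 1) : h '' Set.Ioo 0 1 ∈ 𝓝 (h k) := by
  obtain ⟨hk0, hk1⟩ := hk
  -- A compact interval around `k` inside `(0, 1)`, on which the intermediate value theorem applies.
  have hsub : Set.Icc (k / 2) ((k + 1) / 2) ⊆ Set.Ioo (0 : ℝ) 1 :=
    fun x hx => ⟨by linarith [hx.1], by linarith [hx.2]⟩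
  have hc : ContinuousOn h (Set.Icc (k / 2) ((k + 1) / 2)) :=
    continuousOn_h.mono (hsub.trans Set.Ioo_subset_Ioi_self)
  have hI := intermediate_value_Icc' (show k / 2 ≤ (k + 1) / 2 by linarith) hc
  refine mem_of_superset (Icc_mem_nhds ?_ ?_) (hI.trans (Set.image_mono hsub))
  · exact strictAntiOn_h hk0 (show 0 < (k + 1) / 2 by linarith) (by linarith)
  · exact strictAntiOn_h (show 0 < k / 2 by linarith) hk0 (by linarith)

lemma antitoneOn_hInv : AntitoneOn hInv (h '' Set.Ioc 0 1) := by
  intro a ha b hb hab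
  by_contra! hlt
  have := strictAntiOn_h_Ioc (hInv_mem ha) (hInv_mem hb) hlt
  rw [h_hInv ha, h_hInv hb] at this
  linarith

/-- A monotone function whose image is a neighbourhood of its value has no jump there; this is
applied to `-hInv`. -/
lemma continuousAt_hInv {k : ℝ} (hk : k ∈ Set.Ioo (0 : ℝ) 1) : ContinuousAt hInv (h k) := by
  have hk' := Set.Ioo_subset_Ioc_self hk
  have hsub : h '' Set.Ioo 0 1 ⊆ h '' Set.Ioc 0 1 := Set.image_mono Set.Ioo_subset_Ioc_self
  have himg : hInv '' (h '' Set.Ioc 0 1) ∈ 𝓝 (hInv (h k)) := by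
    rw [hInv_h hk']
    refine mem_of_superset (Ioo_mem_nhds hk.1 hk.2) fun x hx => ?_
    exact ⟨h x, ⟨x, Set.Ioo_subset_Ioc_self hx, rfl⟩, hInv_h (Set.Ioo_subset_Ioc_self hx)⟩
  have hmono : MonotoneOn (fun w => -hInv w) (h '' Set.Ioc 0 1) := antitoneOn_hInv.neg
  have := continuousAt_of_monotoneOn_of_image_mem_nhds hmono
    (mem_of_superset (image_h_Ioo_mem_nhds hk) hsub) (by
      have := (Homeomorph.neg ℝ).isOpenMap.image_mem_nhds himg
      rwa [Set.image_image] at this)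
  simpa only [neg_neg] using this.fun_neg

lemma hasDerivAt_hInv {k : ℝ} (hk : k ∈ Set.Ioo (0 : ℝ) 1) :
    HasDerivAt hInv (hDeriv k)⁻¹ (h k) := by
  have hk' := Set.Ioo_subset_Ioc_self hk
  refine HasDerivAt.of_local_left_inverse (f := h) (continuousAt_hInv hk) ?_
    (hDeriv_neg hk.1).ne ?_
  · rw [hInv_h hk']
    exact hasDerivAt_h hk.1
  · filter_upwards [image_h_Ioo_mem_nhds hk] with w hw
    exact h_hInv (Set.image_mono Set.Ioo_subset_Ioc_self hw)

/-- Needed for the delta method, which asks for `g` to be measurable everywhere: `hInv` is antitone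
on an interval and constant off it. -/
lemma measurable_hInv : Measurable hInv := by
  have hord : (h '' Set.Ioc 0 1).OrdConnected :=
    (isPreconnected_Ioc.image h (continuousOn_h.mono Set.Ioc_subset_Ioi_self)).ordConnected
  refine measurable_of_restrict_of_restrict_compl hord.measurableSet ?_ ?_
  · have : Antitone ((h '' Set.Ioc 0 1).domRestrict hInv) :=
      fun a b hab => antitoneOn_hInv a.2 b.2 hab
    exact this.measurable
  -- Off the range, `Function.invFunOn` returns the same chosen real number for every argument.
  · have : (h '' Set.Ioc 0 1)ᶜ.domRestrict hInv = fun _ => Classical.choice ⟨0⟩ := by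
      ext w
      exact Function.invFunOn_neg w.2
    rw [this]
    exact measurable_const

/-- `Γ` is continuous off the countable set of nonpositive integers, and any function on a countable
set is measurable. -/
lemma measurable_Gamma : Measurable Real.Gamma := by
  have hc : (Set.range fun m : ℕ => -(m : ℝ)).Countable := Set.countable_range _
  refine measurable_of_restrict_of_restrict_compl hc.measurableSet ?_ ?_
  · have := hc.to_subtype
    exact measurable_of_countable _
  · refine (continuousOn_iff_continuous_domRestrict.mp fun x hx => ?_).measurable
    exact (Real.differentiableAt_Gamma fun m hm => hx ⟨m, hm.symm⟩).continuousAt.continuousWithinAt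

/-! ### Moments of the Mittag-Leffler law -/

/-- Bounds the coefficients `1 / Γ(κm+1)` uniformly, so that a geometric series dominates the
Mittag-Leffler series for `|z| < 1`. -/
lemma exists_pos_le_Gamma : ∃ c > 0, ∀ x > 0, c ≤ Real.Gamma x := by
  obtain ⟨x, hx, hmin⟩ := Real.exists_isMinOn_Gamma_Ioi
  exact ⟨Real.Gamma x, Real.Gamma_pos_of_pos (by linarith [hx.1]), fun y hy => hmin hy⟩

lemma hasFPowerSeriesAt_mittagLeffler {κ : ℝ} (hκ : 0 < κ) :
    HasFPowerSeriesAt (mittagLeffler κ)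
      (FormalMultilinearSeries.ofScalars ℝ fun m : ℕ => (Real.Gamma (κ * m + 1))⁻¹) 0 := by
  rw [hasFPowerSeriesAt_iff]
  obtain ⟨c, hc, hΓ⟩ := exists_pos_le_Gamma
  filter_upwards [Metric.ball_mem_nhds (0 : ℝ) one_pos] with z hz
  have hz' : |z| < 1 := by simpa using hz
  have hs : Summable fun m : ℕ => z ^ m / Real.Gamma (κ * m + 1) := by
    refine .of_norm_bounded
      ((summable_geometric_of_lt_one (abs_nonneg z) hz').mul_right c⁻¹) fun m => ?_
    have hpos : 0 < κ * m + 1 := by positivity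
    rw [norm_div, norm_pow, Real.norm_eq_abs, Real.norm_eq_abs,
      abs_of_pos (Real.Gamma_pos_of_pos hpos), div_eq_mul_inv]
    gcongr
    exact hΓ _ hpos
  simpa [FormalMultilinearSeries.coeff_ofScalars, mittagLeffler, div_eq_mul_inv] using hs.hasSum

lemma IsMittagLefflerLaw.integrableExpSet_eq {κ : ℝ} {ν : Measure ℝ}
    (hν : IsMittagLefflerLaw κ ν) : integrableExpSet id ν = Set.univ :=
  Set.eq_univ_of_forall fun s => hν.integrable_exp s

/-- Both sides of `mgf = mittagLeffler` have power series at `0`, with coefficients `E(U^m) / m!`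
and `1 / Γ(κm+1)`; uniqueness of the expansion identifies them. -/
lemma IsMittagLefflerLaw.integral_pow {κ : ℝ} {ν : Measure ℝ} (hκ : 0 < κ)
    (hν : IsMittagLefflerLaw κ ν) (m : ℕ) :
    ∫ u, u ^ m ∂ν = m.factorial / Real.Gamma (κ * m + 1) := by
  have h1 := hasFPowerSeriesAt_mgf (X := id) (μ := ν) (v := 0) (by simp [hν.integrableExpSet_eq])
  have hfun : mgf id ν = mittagLeffler κ := funext hν.mgf_eq
  rw [hfun] at h1
  have h2 := h1.eq_formalMultilinearSeries (hasFPowerSeriesAt_mittagLeffler hκ)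
  have h3 := congrArg (fun p => p.coeff m) h2
  simp only [FormalMultilinearSeries.coeff_ofScalars, id, zero_mul, Real.exp_zero, mul_one] at h3
  have hne : (m.factorial : ℝ) ≠ 0 := by exact_mod_cast m.factorial_ne_zero
  rw [div_eq_iff hne] at h3
  rw [h3, div_eq_mul_inv, mul_comm]

lemma IsMittagLefflerLaw.integrable_pow {κ : ℝ} {ν : Measure ℝ}
    (hν : IsMittagLefflerLaw κ ν) (m : ℕ) : Integrable (fun u => u ^ m) ν :=
  integrable_pow_of_mem_interior_integrableExpSet (X := id)
    (by simp [hν.integrableExpSet_eq]) m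

lemma IsMittagLefflerLaw.ae_pos {κ : ℝ} {ν : Measure ℝ}
    (hν : IsMittagLefflerLaw κ ν) : ∀ᵐ u ∂ν, 0 < u := by
  rw [ae_iff]
  simpa [Set.Iic] using hν.measure_Iic_zero

lemma IsMittagLefflerLaw.integrable_sqrt_pow {κ : ℝ} {ν : Measure ℝ}
    (hν : IsMittagLefflerLaw κ ν) (k : ℕ) : Integrable (fun u => √u ^ k) ν := by
  have := hν.isProbabilityMeasure
  refine ((integrable_const (1 : ℝ)).add (hν.integrable_pow k)).mono'
    (by fun_prop) ?_
  filter_upwards [hν.ae_pos] with u hu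
  rw [Real.norm_of_nonneg (by positivity)]
  simp only [Pi.add_apply]
  -- Domination by `1 + u ^ k`: the first term serves for `u ≤ 1`, the second for `u ≥ 1`, where `√u
  -- ≤ u`.
  rcases le_total u 1 with h1 | h1
  · have : √u ^ k ≤ 1 := pow_le_one₀ (Real.sqrt_nonneg u) (Real.sqrt_le_one.mpr h1)
    have : 0 ≤ u ^ k := by positivity
    linarith
  · have hle : √u ≤ u := Real.sqrt_le_self_iff.mpr (Or.inr h1)
    have := pow_le_pow_left₀ (Real.sqrt_nonneg u) hle k
    linarith

lemma IsMittagLefflerLaw.integral_sqrt_pow_two_mul {κ : ℝ} {ν : Measure ℝ} (hκ : 0 < κ)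
    (hν : IsMittagLefflerLaw κ ν) (m : ℕ) :
    ∫ u, √u ^ (2 * m) ∂ν = m.factorial / Real.Gamma (κ * m + 1) := by
  rw [← hν.integral_pow hκ m]
  refine integral_congr_ae ?_
  filter_upwards [hν.ae_pos] with u hu
  rw [pow_mul, Real.sq_sqrt hu.le]

/-! ### Gaussian moments -/

section Gaussian

/-- Let `I_n(t)` be the integral of `x^n e^{tx}`, so that `I_n' = I_{n+1}`. Since `I_0 = e^{t²/2}`,
one has `I_1 = t I_0`; differentiating this identity repeatedly gives the recurrence. Only `t = 0`
is used later, but the induction needs a function of `t`. -/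
lemma mgf_moment_recurrence (n : ℕ) (t : ℝ) :
    ∫ x, x ^ (n + 2) * Real.exp (t * x) ∂(gaussianReal 0 1) =
      t * ∫ x, x ^ (n + 1) * Real.exp (t * x) ∂(gaussianReal 0 1) +
        (n + 1) * ∫ x, x ^ n * Real.exp (t * x) ∂(gaussianReal 0 1) := by
  have hd (n : ℕ) (t : ℝ) :
      HasDerivAt (fun t => ∫ x, x ^ n * Real.exp (t * x) ∂(gaussianReal 0 1))
        (∫ x, x ^ (n + 1) * Real.exp (t * x) ∂(gaussianReal 0 1)) t :=
    hasDerivAt_integral_pow_mul_exp_real (X := id) (by simp) n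
  have h0 (t : ℝ) : ∫ x, x ^ 0 * Real.exp (t * x) ∂(gaussianReal 0 1) = Real.exp (t ^ 2 / 2) := by
    have := congrFun (mgf_id_gaussianReal (μ := 0) (v := 1)) t
    simpa [mgf] using this
  have h1 (t : ℝ) : ∫ x, x ^ (0 + 1) * Real.exp (t * x) ∂(gaussianReal 0 1) =
      t * ∫ x, x ^ 0 * Real.exp (t * x) ∂(gaussianReal 0 1) := by
    have e : HasDerivAt (fun t : ℝ => Real.exp (t ^ 2 / 2)) (Real.exp (t ^ 2 / 2) * t) t := by
      have : HasDerivAt (fun t : ℝ => t ^ 2 / 2) t t := by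
        refine ((hasDerivAt_pow 2 t).div_const 2).congr_deriv ?_
        simp
      exact this.exp
    have := hd 0 t
    simp_rw [h0] at this ⊢
    rw [this.unique e, mul_comm]
  induction n generalizing t with
  | zero =>
    have e := (hasDerivAt_id t).fun_mul (hd 0 t)
    have := hd (0 + 1) t
    simp_rw [h1] at this
    rw [this.unique e, h1]
    simp
    ring
  | succ n ih =>
    have e := ((hasDerivAt_id t).fun_mul (hd (n + 1) t)).fun_add ((hd n t).const_mul (n + 1 : ℝ))
    have := hd (n + 2) t
    simp_rw [ih] at this
    rw [this.unique e, ih]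
    simp only [id]
    push_cast
    ring

lemma integral_pow_gaussian_add_two (n : ℕ) :
    ∫ x, x ^ (n + 2) ∂(gaussianReal 0 1) = (n + 1) * ∫ x, x ^ n ∂(gaussianReal 0 1) := by
  simpa using mgf_moment_recurrence n 0

lemma integral_pow_gaussian_odd (m : ℕ) : ∫ x, x ^ (2 * m + 1) ∂(gaussianReal 0 1) = 0 := by
  induction m with
  | zero => simp
  | succ m ih =>
    rw [show 2 * (m + 1) + 1 = 2 * m + 1 + 2 by ring, integral_pow_gaussian_add_two, ih, mul_zero]

lemma integrable_pow_gaussian (n : ℕ) : Integrable (fun x => x ^ n) (gaussianReal 0 1) :=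
  integrable_pow_of_mem_interior_integrableExpSet (X := id) (by simp) n

end Gaussian

/-! ### Moments and covariances of the normal Mittag-Leffler law -/

section StdNML

variable {κ : ℝ} {ρ₀ : Measure ℝ}

lemma IsStdNMLLaw.isProbabilityMeasure (hρ : IsStdNMLLaw κ ρ₀) : IsProbabilityMeasure ρ₀ := by
  obtain ⟨ν, hν, rfl⟩ := hρ
  have := hν.isProbabilityMeasure
  exact Measure.isProbabilityMeasure_map (by fun_prop)

lemma IsStdNMLLaw.integrable_pow (hρ : IsStdNMLLaw κ ρ₀) (k : ℕ) :
    Integrable (fun y => y ^ k) ρ₀ := by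
  obtain ⟨ν, hν, rfl⟩ := hρ
  have := hν.isProbabilityMeasure
  rw [integrable_map_measure (by fun_prop) (by fun_prop)]
  refine ((hν.integrable_sqrt_pow k).mul_prod (integrable_pow_gaussian k)).congr ?_
  exact .of_forall fun p => by simp [mul_pow]

lemma IsStdNMLLaw.integral_pow_odd (hρ : IsStdNMLLaw κ ρ₀) (m : ℕ) :
    ∫ y, y ^ (2 * m + 1) ∂ρ₀ = 0 := by
  obtain ⟨ν, hν, rfl⟩ := hρ
  have := hν.isProbabilityMeasure
  rw [integral_map (by fun_prop) (by fun_prop)]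
  simp_rw [mul_pow]
  rw [integral_prod_mul (fun u : ℝ => √u ^ (2 * m + 1)) (fun z : ℝ => z ^ (2 * m + 1)),
    integral_pow_gaussian_odd, mul_zero]

lemma IsStdNMLLaw.integral_pow_even (hκ : 0 < κ) (hρ : IsStdNMLLaw κ ρ₀) (m : ℕ) :
    ∫ y, y ^ (2 * m) ∂ρ₀ =
      m.factorial / Real.Gamma (κ * m + 1) * ∫ z, z ^ (2 * m) ∂(gaussianReal 0 1) := by
  obtain ⟨ν, hν, rfl⟩ := hρ
  have := hν.isProbabilityMeasure
  rw [integral_map (by fun_prop) (by fun_prop)]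
  simp_rw [mul_pow]
  rw [integral_prod_mul (fun u : ℝ => √u ^ (2 * m)) (fun z : ℝ => z ^ (2 * m)),
    hν.integral_sqrt_pow_two_mul hκ]

end StdNML

section NMLMoments

variable {μ σ κ : ℝ} {ρ : Measure ℝ}

lemma IsNMLLaw.isProbabilityMeasure (hρ : IsNMLLaw μ σ κ ρ) : IsProbabilityMeasure ρ := by
  obtain ⟨ρ₀, hρ₀, rfl⟩ := hρ
  have := hρ₀.isProbabilityMeasure
  exact Measure.isProbabilityMeasure_map (by fun_prop)

lemma IsNMLLaw.integrable_pow (hρ : IsNMLLaw μ σ κ ρ) (k : ℕ) :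
    Integrable (fun x => x ^ k) ρ := by
  obtain ⟨ρ₀, hρ₀, rfl⟩ := hρ
  rw [integrable_map_measure (by fun_prop) (by fun_prop)]
  simp only [Function.comp_def, add_pow, mul_pow]
  exact integrable_finsetSum _ fun i _ =>
    (((hρ₀.integrable_pow i).const_mul _).mul_const _).mul_const _

lemma IsNMLLaw.popMoment_eq_sum (hρ : IsNMLLaw μ σ κ ρ) :
    ∃ ρ₀, IsStdNMLLaw κ ρ₀ ∧ ∀ k, popMoment ρ k =
      ∑ i ∈ Finset.range (k + 1), σ ^ i * (∫ y, y ^ i ∂ρ₀) * μ ^ (k - i) * k.choose i := by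
  obtain ⟨ρ₀, hρ₀, rfl⟩ := hρ
  refine ⟨ρ₀, hρ₀, fun k => ?_⟩
  rw [popMoment, integral_map (by fun_prop) (by fun_prop)]
  simp only [add_pow, mul_pow]
  rw [integral_finsetSum _ fun i _ =>
    (((hρ₀.integrable_pow i).const_mul _).mul_const _).mul_const _]
  simp only [integral_mul_const, integral_const_mul]

/-- The listed orders are `1, 2, 4` and all sums of two of them, which is what the covariances of
`(Y, Y², Y⁴)` involve. -/
lemma IsNMLLaw.popMoment_formulas (hκ : 0 < κ) (hρ : IsNMLLaw μ σ κ ρ) :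
    popMoment ρ 1 = μ ∧
    popMoment ρ 2 = σ ^ 2 / Real.Gamma (κ + 1) + μ ^ 2 ∧
    popMoment ρ 3 = 3 * μ * σ ^ 2 / Real.Gamma (κ + 1) + μ ^ 3 ∧
    popMoment ρ 4 = 6 * σ ^ 4 / Real.Gamma (2 * κ + 1) + 6 * μ ^ 2 * σ ^ 2 / Real.Gamma (κ + 1)
      + μ ^ 4 ∧
    popMoment ρ 5 = 30 * μ * σ ^ 4 / Real.Gamma (2 * κ + 1)
      + 10 * μ ^ 3 * σ ^ 2 / Real.Gamma (κ + 1) + μ ^ 5 ∧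
    popMoment ρ 6 = 90 * σ ^ 6 / Real.Gamma (3 * κ + 1)
      + 90 * μ ^ 2 * σ ^ 4 / Real.Gamma (2 * κ + 1)
      + 15 * μ ^ 4 * σ ^ 2 / Real.Gamma (κ + 1) + μ ^ 6 ∧
    popMoment ρ 8 = 2520 * σ ^ 8 / Real.Gamma (4 * κ + 1)
      + 2520 * μ ^ 2 * σ ^ 6 / Real.Gamma (3 * κ + 1)
      + 420 * μ ^ 4 * σ ^ 4 / Real.Gamma (2 * κ + 1)
      + 28 * μ ^ 6 * σ ^ 2 / Real.Gamma (κ + 1) + μ ^ 8 := by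
  obtain ⟨ρ₀, hρ₀, hk⟩ := hρ.popMoment_eq_sum
  have := hρ₀.isProbabilityMeasure
  have g0 : ∫ z, z ^ 0 ∂(gaussianReal 0 1) = 1 := by simp
  have g2 : ∫ z, z ^ 2 ∂(gaussianReal 0 1) = 1 := by
    rw [integral_pow_gaussian_add_two 0, g0]; norm_num
  have g4 : ∫ z, z ^ 4 ∂(gaussianReal 0 1) = 3 := by
    rw [integral_pow_gaussian_add_two 2, g2]; norm_num
  have g6 : ∫ z, z ^ 6 ∂(gaussianReal 0 1) = 15 := by
    rw [integral_pow_gaussian_add_two 4, g4]; norm_num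
  have g8 : ∫ z, z ^ 8 ∂(gaussianReal 0 1) = 105 := by
    rw [integral_pow_gaussian_add_two 6, g6]; norm_num
  have a0 : ∫ y, y ^ 0 ∂ρ₀ = 1 := by simp
  have a1 := hρ₀.integral_pow_odd 0
  have a3 := hρ₀.integral_pow_odd 1
  have a5 := hρ₀.integral_pow_odd 2
  have a7 := hρ₀.integral_pow_odd 3
  have a2 := hρ₀.integral_pow_even hκ 1
  have a4 := hρ₀.integral_pow_even hκ 2
  have a6 := hρ₀.integral_pow_even hκ 3
  have a8 := hρ₀.integral_pow_even hκ 4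
  norm_num only [g2, g4, g6, g8, Nat.factorial, mul_one, mul_comm κ, one_mul]
    at a1 a2 a3 a4 a5 a6 a7 a8
  refine ⟨?_, ?_, ?_, ?_, ?_, ?_, ?_⟩ <;>
  · rw [hk]
    simp only [Finset.sum_range_succ, Finset.sum_range_zero, a0, a1, a2, a3, a4, a5, a6, a7, a8]
    norm_num [Nat.choose]
    try ring

lemma IsNMLLaw.memLp_pow (hρ : IsNMLLaw μ σ κ ρ) (k : ℕ) :
    MemLp (fun x : ℝ => x ^ k) 2 ρ := by
  rw [memLp_two_iff_integrable_sq (by fun_prop)]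
  simpa only [← pow_mul] using hρ.integrable_pow (k * 2)

lemma IsNMLLaw.covariance_pow (hρ : IsNMLLaw μ σ κ ρ) (i j : ℕ) :
    covariance (fun x : ℝ => x ^ i) (fun x : ℝ => x ^ j) ρ =
      popMoment ρ (i + j) - popMoment ρ i * popMoment ρ j := by
  have := hρ.isProbabilityMeasure
  rw [covariance_eq_sub (hρ.memLp_pow i) (hρ.memLp_pow j)]
  simp only [popMoment, Pi.mul_def, pow_add]

lemma IsNMLLaw.covMatrix_eq_covariance (hκ : 0 < κ) (hρ : IsNMLLaw μ σ κ ρ) (i j : Fin 3) :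
    covMatrix μ σ κ i j =
      covariance (fun x : ℝ => x ^ (![1, 2, 4] i : ℕ)) (fun x : ℝ => x ^ (![1, 2, 4] j : ℕ)) ρ := by
  obtain ⟨m1, m2, m3, m4, m5, m6, m8⟩ := hρ.popMoment_formulas hκ
  have hG (c : ℝ) (hc : 0 < c) : Real.Gamma (c * κ + 1) ≠ 0 :=
    (Real.Gamma_pos_of_pos (by positivity)).ne'
  have G1 := hG 1 one_pos
  have G2 := hG 2 two_pos
  have G3 := hG 3 three_pos
  have G4 := hG 4 four_pos
  rw [one_mul] at G1
  rw [hρ.covariance_pow]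
  fin_cases i <;> fin_cases j <;>
    simp [covMatrix, m1, m2, m3, m4, m5, m6, m8] <;> field_simp <;> ring

end NMLMoments

/-! ### Multivariate central limit theorem and delta method -/

lemma charFun_eq_charFun_inner {Ω E : Type*} [MeasurableSpace Ω] [NormedAddCommGroup E]
    [InnerProductSpace ℝ E] [MeasurableSpace E] [BorelSpace E] [SecondCountableTopology E]
    {P : Measure Ω} {X : Ω → E}
    (hX : AEMeasurable X P) (t : E) :
    charFun (P.map X) t = charFun (P.map fun ω => inner ℝ (X ω) t) 1 := by
  rw [charFun_apply, charFun_apply, integral_map hX (by fun_prop),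
    integral_map (by fun_prop) (by fun_prop)]
  simp

/-- Cramér–Wold: the characteristic function at `t` is that of the projection on `t` at `1`, so the
scalar theorem for each projection gives pointwise convergence, and Lévy's theorem concludes. -/
theorem tendstoInDistribution_multivariate_clt {Ω ι : Type*} [Fintype ι] [DecidableEq ι]
    [MeasurableSpace Ω] {P : Measure Ω} [IsProbabilityMeasure P]
    {V : ℕ → Ω → EuclideanSpace ℝ ι} {S : Matrix ι ι ℝ} (hS : S.PosSemidef)
    (hV : MemLp (V 0) 2 P) (hindep : iIndepFun V P)
    (hident : ∀ i, IdentDistrib (V i) (V 0) P P)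
    (hvar : ∀ t : EuclideanSpace ℝ ι,
      Var[fun ω => inner ℝ (V 0 ω) t; P] = t.ofLp ⬝ᵥ S.mulVec t.ofLp) :
    TendstoInDistribution
      (fun (n : ℕ) ω => (√(n : ℝ))⁻¹ • (∑ k ∈ Finset.range n, V k ω - (n : ℝ) • P[V 0]))
      atTop id (fun _ => P) (multivariateGaussian 0 S) := by
  have hm (i : ℕ) : AEMeasurable (V i) P := (hident i).aemeasurable_fst
  have hmeas (n : ℕ) : AEMeasurable
      (fun ω => (√(n : ℝ))⁻¹ • (∑ k ∈ Finset.range n, V k ω - (n : ℝ) • P[V 0])) P :=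
    ((Finset.aemeasurable_fun_sum (Finset.range n) fun i _ => hm i).sub_const _).fun_const_smul _
  refine ⟨hmeas, aemeasurable_id, ?_⟩
  refine ProbabilityMeasure.tendsto_iff_tendsto_charFun.2 fun t => ?_
  have hinner : Measurable fun v : EuclideanSpace ℝ ι => inner ℝ v t := by fun_prop
  have hint : Integrable (V 0) P := hV.integrable (by norm_num)
  have hmean : P[fun ω => inner ℝ (V 0 ω) t] = inner ℝ P[V 0] t := by
    simp_rw [real_inner_comm t]
    exact integral_inner hint t
  have hclt := tendstoInDistribution_inv_sqrt_mul_sum_sub (P := P)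
    (X := fun i ω => inner ℝ (V i ω) t) (Y := id)
    (P' := gaussianReal 0 Var[fun ω => inner ℝ (V 0 ω) t; P].toNNReal)
    ⟨aemeasurable_id, Measure.map_id⟩ (hV.inner_const t)
    (hindep.comp (fun _ v => inner ℝ v t) fun _ => hinner)
    (fun i => (hident i).comp hinner)
  have h1 := (ProbabilityMeasure.tendsto_iff_tendsto_charFun.1 hclt.tendsto) 1
  simp only [ProbabilityMeasure.coe_mk, Measure.map_id, charFun_gaussianReal,
    charFun_multivariateGaussian hS, hvar] at h1 ⊢
  have hnn : 0 ≤ t.ofLp ⬝ᵥ S.mulVec t.ofLp := by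
    rw [← hvar]; exact variance_nonneg _ _
  rw [Real.coe_toNNReal _ hnn] at h1
  refine Tendsto.congr (fun n => ?_) (h1.trans_eq ?_)
  · rw [charFun_eq_charFun_inner (hmeas n)]
    congr 2
    ext ω
    rw [hmean, real_inner_smul_left, inner_sub_left, sum_inner, real_inner_smul_left]
  · simp

/-- The **delta method**. -/
theorem tendstoInDistribution_delta_method {Ω Ω' E F : Type*} [MeasurableSpace Ω]
    [MeasurableSpace Ω'] [NormedAddCommGroup E] [NormedSpace ℝ E] [MeasurableSpace E]
    [BorelSpace E] [SecondCountableTopology E] [NormedAddCommGroup F] [NormedSpace ℝ F]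
    [MeasurableSpace F] [BorelSpace F] [SecondCountableTopology F]
    {P : Measure Ω} [IsProbabilityMeasure P] {P' : Measure Ω'} [IsProbabilityMeasure P']
    {a : ℕ → ℝ} (ha : ∀ n, 0 ≤ a n) {X : ℕ → Ω → E} {Z : Ω' → E} {m : E}
    (hX : ∀ n, AEMeasurable (X n) P) (hlim : ∀ᵐ ω ∂P, Tendsto (fun n => X n ω) atTop (𝓝 m))
    (hdist : TendstoInDistribution (fun n ω => a n • (X n ω - m)) atTop Z (fun _ => P) P')
    {f : E → F} (hf : Measurable f) {L : E →L[ℝ] F} (hL : HasFDerivAt f L m) :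
    TendstoInDistribution (fun n ω => a n • (f (X n ω) - f m)) atTop (fun ω => L (Z ω))
      (fun _ => P) P' := by
  -- The normalised Taylor remainder, so that `a (f X - f m) = L (a (X - m)) + ‖a (X - m)‖ ε(X)`. As
  -- `X → m` almost surely, `ε(X) → 0` in probability, and Slutsky's theorem removes the last term.
  -- The factors `a n` need not tend to infinity.
  set ε : E → F := fun x => ‖x - m‖⁻¹ • (f x - f m - L (x - m)) with hε
  have hεm : Measurable ε := by
    have : Measurable fun x => L (x - m) := by fun_prop
    exact Measurable.smul (by fun_prop) ((hf.sub_const _).sub this)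
  have hε0 : Tendsto ε (𝓝 m) (𝓝 0) := by
    rw [tendsto_zero_iff_norm_tendsto_zero]
    have := hasFDerivAt_iff_tendsto.1 hL
    simpa [hε, norm_smul] using this
  have hR : TendstoInMeasure P (fun n ω => ε (X n ω)) atTop fun _ => (0 : F) := by
    refine tendstoInMeasure_of_tendsto_ae
      (fun n => (hεm.comp_aemeasurable (hX n)).aestronglyMeasurable) ?_
    filter_upwards [hlim] with ω hω
    exact hε0.comp hω
  have := hdist.continuous_comp_prodMk_of_tendstoInMeasure_const
    (g := fun p : E × F => L p.1 + ‖p.1‖ • p.2) (by fun_prop) hR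
    fun n => hεm.comp_aemeasurable (hX n)
  convert this using 3 with n ω n
  · rename_i ω
    simp only [hε, norm_smul, map_smul, Real.norm_of_nonneg (ha n), smul_smul]
    -- At `X = m` the inverse norm is `0` by convention, but both sides vanish.
    rcases eq_or_ne (X n ω) m with h | h
    · simp [h]
    · have : ‖X n ω - m‖ ≠ 0 := norm_ne_zero_iff.2 (sub_ne_zero.2 h)
      rw [mul_assoc, mul_inv_cancel₀ this, mul_one, ← smul_add]
      congr 1
      abel
  · simp

/-- Compare characteristic functions, moving `A` across the inner product as its transpose. -/
lemma map_toEuclideanCLM_multivariateGaussian {ι : Type*} [Fintype ι] [DecidableEq ι]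
    {S : Matrix ι ι ℝ} (hS : S.PosSemidef) (A : Matrix ι ι ℝ) :
    (multivariateGaussian 0 S).map (Matrix.toEuclideanCLM (𝕜 := ℝ) A) =
      multivariateGaussian 0 (A * S * A.transpose) := by
  have hS' : (A * S * A.transpose).PosSemidef := by
    simpa using hS.mul_mul_conjTranspose_same A
  refine Measure.ext_of_charFun (funext fun t => ?_)
  have hinner (x : EuclideanSpace ℝ ι) : inner ℝ (Matrix.toEuclideanCLM (𝕜 := ℝ) A x) t =
      inner ℝ x (Matrix.toEuclideanCLM (𝕜 := ℝ) A.transpose t) := by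
    rw [real_inner_comm, Matrix.inner_toEuclideanCLM, Matrix.inner_toEuclideanCLM,
      Matrix.dotProduct_mulVec x.ofLp, Matrix.vecMul_transpose, dotProduct_comm]
  have hmap : charFun ((multivariateGaussian 0 S).map (Matrix.toEuclideanCLM (𝕜 := ℝ) A)) t =
      charFun (multivariateGaussian 0 S) (Matrix.toEuclideanCLM (𝕜 := ℝ) A.transpose t) := by
    rw [charFun_apply, charFun_apply, integral_map (by fun_prop) (by fun_prop)]
    simp_rw [hinner]
  rw [hmap, charFun_multivariateGaussian hS, charFun_multivariateGaussian hS']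
  simp only [inner_zero_right, Matrix.ofLp_toEuclideanCLM]
  rw [← Matrix.mulVec_mulVec, ← Matrix.mulVec_mulVec, Matrix.dotProduct_mulVec _ A,
    ← Matrix.mulVec_transpose]

/-! ### Solving the method-of-moments system -/

lemma solvesSystem_iff {x y z : ℝ} (hxy : x ^ 2 < y) (hr : ratio x y z ∈ h '' Set.Ioc 0 1)
    (m s k : ℝ) : SolvesSystem x y z m s k ↔ !₂[m, s, k] = g !₂[x, y, z] := by
  have hD : 0 < y - x ^ 2 := sub_pos.2 hxy
  have hg : !₂[m, s, k] = g !₂[x, y, z] ↔ m = x ∧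
      s = (y - x ^ 2) * Real.Gamma (hInv (ratio x y z) + 1) ∧ k = hInv (ratio x y z) := by
    simp [g]
  rw [hg]
  constructor
  · rintro ⟨hs, hk, rfl, hy, hz⟩
    have G1 := Real.Gamma_pos_of_pos (s := k + 1) (by linarith [hk.1])
    have G2 := Real.Gamma_pos_of_pos (s := 2 * k + 1) (by linarith [hk.1])
    have hy' : y - m ^ 2 = s / Real.Gamma (k + 1) := by linarith
    have hk' : ratio m y z = h k := by
      rw [ratio, hy', ← hz, ← hy, h]
      field_simp
      ring
    rw [hk', hInv_h hk, hy']
    exact ⟨rfl, by field_simp, rfl⟩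
  · rintro ⟨rfl, rfl, rfl⟩
    have hk := hInv_mem hr
    have hh := h_hInv hr
    set k := hInv (ratio m y z) with hkdef
    have G1 := Real.Gamma_pos_of_pos (s := k + 1) (by linarith [hk.1])
    have G2 := Real.Gamma_pos_of_pos (s := 2 * k + 1) (by linarith [hk.1])
    refine ⟨by positivity, hk, rfl, by field_simp; ring, ?_⟩
    rw [h, ratio, div_eq_div_iff G2.ne' (by positivity)] at hh
    have e1 : 6 * ((y - m ^ 2) * Real.Gamma (k + 1)) ^ 2 / Real.Gamma (2 * k + 1) =
        z - 6 * m ^ 2 * y + 5 * m ^ 4 := by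
      rw [div_eq_iff G2.ne']
      linear_combination hh
    have e2 : 6 * m ^ 2 * ((y - m ^ 2) * Real.Gamma (k + 1)) / Real.Gamma (k + 1) =
        6 * m ^ 2 * (y - m ^ 2) := by
      field_simp
    rw [e1, e2]
    ring

/-- At the population moments this provides the hypotheses of `solvesSystem_iff` and
`hasFDerivAt_g`. -/
lemma SolvesSystem.ratio_eq {x y z m s k : ℝ} (hs : SolvesSystem x y z m s k) :
    x ^ 2 < y ∧ ratio x y z = h k := by
  obtain ⟨hs, hk, rfl, hy, hz⟩ := hs
  have G1 := Real.Gamma_pos_of_pos (s := k + 1) (by linarith [hk.1])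
  have G2 := Real.Gamma_pos_of_pos (s := 2 * k + 1) (by linarith [hk.1])
  have hy' : y - m ^ 2 = s / Real.Gamma (k + 1) := by linarith
  have : 0 < s / Real.Gamma (k + 1) := by positivity
  refine ⟨by linarith, ?_⟩
  rw [ratio, hy', ← hz, ← hy, h]
  field_simp
  ring

/-! ### The Jacobian of `g` -/

section Jacobian

/-- The `i`-th coordinate on `ℝ³`. -/
noncomputable abbrev coordCLM (i : Fin 3) : EuclideanSpace ℝ (Fin 3) →L[ℝ] ℝ := EuclideanSpace.proj i

lemma hasFDerivAt_coord (i : Fin 3) (v : EuclideanSpace ℝ (Fin 3)) :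
    HasFDerivAt (fun v : EuclideanSpace ℝ (Fin 3) => v i) (coordCLM i) v :=
  (coordCLM i).hasFDerivAt

lemma hasFDerivAt_ratio {x y z : ℝ} (hD : y ≠ x ^ 2) :
    HasFDerivAt (fun v : EuclideanSpace ℝ (Fin 3) => ratio (v 0) (v 1) (v 2))
      (((4 * x ^ 3 * y - 6 * x * y ^ 2 + 2 * x * z) / (3 * (y - x ^ 2) ^ 3)) • coordCLM 0 +
        ((-2 * x ^ 4 + 3 * x ^ 2 * y - z) / (3 * (y - x ^ 2) ^ 3)) • coordCLM 1 +
        (1 / (6 * (y - x ^ 2) ^ 2)) • coordCLM 2) !₂[x, y, z] := by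
  have hD' : y - x ^ 2 ≠ 0 := sub_ne_zero.2 hD
  have p0 := hasFDerivAt_coord 0 !₂[x, y, z]
  have p1 := hasFDerivAt_coord 1 !₂[x, y, z]
  have p2 := hasFDerivAt_coord 2 !₂[x, y, z]
  have hnum := (p2.fun_sub (((p0.pow 2).const_mul 6).fun_mul p1)).fun_add
    ((p0.pow 4).const_mul 5)
  have hden := ((p1.fun_sub (p0.pow 2)).pow 2).const_mul 6
  have hdiv := hnum.fun_mul ((hasDerivAt_inv (by simpa using hD')).comp_hasFDerivAt _ hden)
  simp only [Function.comp_apply, ← div_eq_mul_inv] at hdiv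
  refine HasFDerivAt.congr_fderiv (f := fun v : EuclideanSpace ℝ (Fin 3) => ratio (v 0) (v 1) (v 2))
    hdiv ?_
  ext v
  simp
  field_simp
  ring

lemma hasFDerivAt_hInv_ratio {x y z : ℝ} (hD : y ≠ x ^ 2)
    (hr : ratio x y z ∈ h '' Set.Ioo 0 1) :
    HasFDerivAt (fun v : EuclideanSpace ℝ (Fin 3) => hInv (ratio (v 0) (v 1) (v 2)))
      (dxInv x y z • coordCLM 0 + dyInv x y z • coordCLM 1 + dzInv x y z • coordCLM 2)
      !₂[x, y, z] := by
  obtain ⟨k, hk, hkr⟩ := hr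
  have hinv : hInv (ratio x y z) = k := by rw [← hkr, hInv_h (Set.Ioo_subset_Ioc_self hk)]
  have hd := hasDerivAt_hInv hk
  rw [hkr] at hd
  refine (hd.comp_hasFDerivAt (f := fun v : EuclideanSpace ℝ (Fin 3) => ratio (v 0) (v 1) (v 2))
    !₂[x, y, z] (hasFDerivAt_ratio hD)).congr_fderiv ?_
  ext v
  simp [dxInv, dyInv, dzInv, hinv]
  ring

lemma hasFDerivAt_g {x y z : ℝ} (hD : y ≠ x ^ 2) (hr : ratio x y z ∈ h '' Set.Ioo 0 1) :
    HasFDerivAt g (Matrix.toEuclideanCLM (𝕜 := ℝ) (gradG x y z)) !₂[x, y, z] := by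
  have hI := hasFDerivAt_hInv_ratio hD hr
  have hpos : 0 < hInv (ratio x y z) :=
    (hInv_mem (Set.image_mono Set.Ioo_subset_Ioc_self hr)).1
  have p0 := hasFDerivAt_coord 0 !₂[x, y, z]
  have p1 := hasFDerivAt_coord 1 !₂[x, y, z]
  have hΓ := (hasDerivAt_Gamma_of_pos (x := hInv (ratio x y z) + 1) (by linarith)).comp_hasFDerivAt
    (f := fun v : EuclideanSpace ℝ (Fin 3) => hInv (ratio (v 0) (v 1) (v 2)) + 1)
    !₂[x, y, z] (hI.add_const 1)
  have hs := (p1.fun_sub (p0.pow 2)).fun_mul hΓ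
  rw [← hasFDerivWithinAt_univ, hasFDerivWithinAt_euclidean]
  intro i
  rw [hasFDerivWithinAt_univ]
  fin_cases i
  · refine p0.congr_fderiv ?_
    ext v
    simp [gradG, Matrix.mulVec, dotProduct, Fin.sum_univ_three]
  · refine hs.congr_fderiv ?_
    ext v
    simp [gradG, gammaDerivInv, Matrix.mulVec, dotProduct, Fin.sum_univ_three]
    ring
  · refine hI.congr_fderiv ?_
    ext v
    simp [gradG, Matrix.mulVec, dotProduct, Fin.sum_univ_three]

end Jacobian

lemma measurable_g : Measurable g := by
  have hr : Measurable fun v : EuclideanSpace ℝ (Fin 3) => hInv (ratio (v 0) (v 1) (v 2)) := by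
    refine measurable_hInv.comp ?_
    unfold ratio
    fun_prop
  have hΓ : Measurable fun v : EuclideanSpace ℝ (Fin 3) =>
      Real.Gamma (hInv (ratio (v 0) (v 1) (v 2)) + 1) := measurable_Gamma.comp (hr.add_const 1)
  refine (WithLp.measurable_toLp 2 (Fin 3 → ℝ)).comp (measurable_pi_iff.2 fun i => ?_)
  fin_cases i
  · exact (by fun_prop : Measurable fun v : EuclideanSpace ℝ (Fin 3) => v 0)
  · exact (by fun_prop : Measurable fun v : EuclideanSpace ℝ (Fin 3) => v 1 - v 0 ^ 2).mul hΓ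
  · exact hr

lemma ratio_image_mem {μ σ κ : ℝ} {ρ : Measure ℝ} (hκ : κ ∈ Set.Ioo (0 : ℝ) 1)
    (hsys : SolvesSystem (popMoment ρ 1) (popMoment ρ 2) (popMoment ρ 4) μ (σ ^ 2) κ) :
    ratio (popMoment ρ 1) (popMoment ρ 2) (popMoment ρ 4) ∈ h '' Set.Ioo 0 1 :=
  ⟨κ, hκ, hsys.ratio_eq.2.symm⟩

lemma IsNMLLaw.solvesSystem {μ σ κ : ℝ} {ρ : Measure ℝ} (hσ : 0 < σ)
    (hκ : κ ∈ Set.Ioo (0 : ℝ) 1) (hρ : IsNMLLaw μ σ κ ρ) :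
    SolvesSystem (popMoment ρ 1) (popMoment ρ 2) (popMoment ρ 4) μ (σ ^ 2) κ := by
  obtain ⟨m1, m2, -, m4, -⟩ := hρ.popMoment_formulas hκ.1
  refine ⟨by positivity, Set.Ioo_subset_Ioc_self hκ, m1.symm, m2.symm, ?_⟩
  rw [m4]
  ring

/-! ### The random vector of powers -/

/-- The vector `(y, y², y⁴)`. -/
def powVec (y : ℝ) : EuclideanSpace ℝ (Fin 3) :=
  !₂[y ^ 1, y ^ 2, y ^ 4]

lemma measurable_powVec : Measurable powVec := by
  refine (WithLp.measurable_toLp 2 (Fin 3 → ℝ)).comp (measurable_pi_iff.2 fun i => ?_)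
  fin_cases i <;> simp <;> fun_prop

lemma powVec_apply (y : ℝ) (i : Fin 3) : powVec y i = y ^ (![1, 2, 4] i : ℕ) := by
  fin_cases i <;> rfl

lemma IsNMLLaw.memLp_powVec {μ σ κ : ℝ} {ρ : Measure ℝ} (hρ : IsNMLLaw μ σ κ ρ) :
    MemLp powVec 2 ρ := by
  rw [memLp_piLp_iff]
  intro i
  simpa only [powVec_apply] using hρ.memLp_pow _

lemma IsNMLLaw.integral_powVec {μ σ κ : ℝ} {ρ : Measure ℝ} (hρ : IsNMLLaw μ σ κ ρ) :
    ∫ y, powVec y ∂ρ = !₂[popMoment ρ 1, popMoment ρ 2, popMoment ρ 4] := by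
  have := hρ.isProbabilityMeasure
  have hint : Integrable powVec ρ := hρ.memLp_powVec.integrable (by norm_num)
  ext i
  have := (coordCLM i).integral_comp_comm hint
  refine this.symm.trans ?_
  simp only [PiLp.proj_apply, powVec_apply]
  fin_cases i <;> rfl

lemma IsNMLLaw.variance_inner_powVec {μ σ κ : ℝ} {ρ : Measure ℝ} (hκ : 0 < κ)
    (hρ : IsNMLLaw μ σ κ ρ) (t : EuclideanSpace ℝ (Fin 3)) :
    Var[fun y => inner ℝ (powVec y) t; ρ] = t.ofLp ⬝ᵥ (covMatrix μ σ κ).mulVec t.ofLp := by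
  have := hρ.isProbabilityMeasure
  have heq : (fun y => inner ℝ (powVec y) t) =
      fun y => ∑ i, t i * y ^ (![1, 2, 4] i : ℕ) := by
    ext y
    simp only [PiLp.inner_apply, powVec_apply]
    rfl
  rw [heq, variance_fun_sum' fun i _ => (hρ.memLp_pow _).const_mul _]
  simp only [covariance_const_mul_left, covariance_const_mul_right, dotProduct, Matrix.mulVec,
    Finset.mul_sum, hρ.covMatrix_eq_covariance hκ]
  exact Finset.sum_congr rfl fun i _ => Finset.sum_congr rfl fun j _ => by ring

/-- The quadratic form at `x` is the variance of a linear combination of the powers. -/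
lemma IsNMLLaw.posSemidef_covMatrix {μ σ κ : ℝ} {ρ : Measure ℝ} (hκ : 0 < κ)
    (hρ : IsNMLLaw μ σ κ ρ) : (covMatrix μ σ κ).PosSemidef := by
  refine Matrix.PosSemidef.of_dotProduct_mulVec_nonneg ?_ fun x => ?_
  · ext i j
    simp only [Matrix.conjTranspose_apply, star_trivial, hρ.covMatrix_eq_covariance hκ]
    exact covariance_comm _ _
  · simp [← hρ.variance_inner_powVec hκ (WithLp.toLp 2 x), variance_nonneg]

/-! ### Limit theorems for the estimators -/

section Sample

variable {Ω : Type*} [MeasurableSpace Ω] {P : Measure Ω} {Y : ℕ → Ω → ℝ}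
  {μ σ κ : ℝ} {ρ : Measure ℝ}

lemma sampleMoment_eq (y : ℕ → ℝ) (n : ℕ) :
    !₂[sampleMoment y n 1, sampleMoment y n 2, sampleMoment y n 4] =
      (n : ℝ)⁻¹ • ∑ i ∈ Finset.range n, powVec (y i) := by
  ext i
  simp only [PiLp.smul_apply, WithLp.ofLp_sum, Finset.sum_apply, powVec_apply, smul_eq_mul]
  fin_cases i <;> simp [sampleMoment]

lemma identDistrib_powVec (hlaw : ∀ i, HasLaw (Y i) ρ P) (i : ℕ) :
    IdentDistrib (fun ω => powVec (Y i ω)) (fun ω => powVec (Y 0 ω)) P P :=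
  IdentDistrib.comp (u := powVec)
    ⟨(hlaw i).aemeasurable, (hlaw 0).aemeasurable, (hlaw i).map_eq.trans (hlaw 0).map_eq.symm⟩
    measurable_powVec

lemma IsNMLLaw.memLp_powVec_comp (hρ : IsNMLLaw μ σ κ ρ) (hlaw : ∀ i, HasLaw (Y i) ρ P) :
    MemLp (fun ω => powVec (Y 0 ω)) 2 P := by
  have := hρ.memLp_powVec
  rw [← (hlaw 0).map_eq] at this
  exact this.comp_of_map (hlaw 0).aemeasurable

lemma IsNMLLaw.integral_powVec_comp (hρ : IsNMLLaw μ σ κ ρ) (hlaw : ∀ i, HasLaw (Y i) ρ P) :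
    ∫ ω, powVec (Y 0 ω) ∂P = !₂[popMoment ρ 1, popMoment ρ 2, popMoment ρ 4] := by
  rw [← hρ.integral_powVec, ← (hlaw 0).map_eq,
    integral_map (hlaw 0).aemeasurable measurable_powVec.aestronglyMeasurable]

variable [IsProbabilityMeasure P]

lemma IsNMLLaw.ae_tendsto_sampleMoment (hρ : IsNMLLaw μ σ κ ρ) (hindep : iIndepFun Y P)
    (hlaw : ∀ i, HasLaw (Y i) ρ P) :
    ∀ᵐ ω ∂P, Tendsto (fun n => !₂[sampleMoment (fun i => Y i ω) n 1,
      sampleMoment (fun i => Y i ω) n 2, sampleMoment (fun i => Y i ω) n 4]) atTop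
      (𝓝 !₂[popMoment ρ 1, popMoment ρ 2, popMoment ρ 4]) := by
  have hind := hindep.comp (fun _ => powVec) fun _ => measurable_powVec
  have hslln := strong_law_ae (μ := P) (fun i ω => powVec (Y i ω))
    ((hρ.memLp_powVec_comp hlaw).integrable (by norm_num))
    (fun i j hij => hind.indepFun hij) (identDistrib_powVec hlaw)
  simp only [hρ.integral_powVec_comp hlaw] at hslln
  simpa only [sampleMoment_eq] using hslln

lemma g_popMoment (hκ : κ ∈ Set.Ioo (0 : ℝ) 1)
    (hsys : SolvesSystem (popMoment ρ 1) (popMoment ρ 2) (popMoment ρ 4) μ (σ ^ 2) κ) :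
    g !₂[popMoment ρ 1, popMoment ρ 2, popMoment ρ 4] = !₂[μ, σ ^ 2, κ] :=
  ((solvesSystem_iff hsys.ratio_eq.1 (Set.image_mono Set.Ioo_subset_Ioc_self
    (ratio_image_mem hκ hsys)) _ _ _).1 hsys).symm

lemma g_sampleMoment (y : ℕ → ℝ) (n : ℕ) :
    g !₂[sampleMoment y n 1, sampleMoment y n 2, sampleMoment y n 4] =
      !₂[muHat y n, sigmaSqHat y n, kappaHat y n] := rfl

lemma IsNMLLaw.ae_tendsto_estimators (hσ : 0 < σ) (hκ : κ ∈ Set.Ioo (0 : ℝ) 1)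
    (hρ : IsNMLLaw μ σ κ ρ) (hindep : iIndepFun Y P) (hlaw : ∀ i, HasLaw (Y i) ρ P) :
    ∀ᵐ ω ∂P, Tendsto (fun n => !₂[muHat (fun i => Y i ω) n, sigmaSqHat (fun i => Y i ω) n,
      kappaHat (fun i => Y i ω) n]) atTop (𝓝 !₂[μ, σ ^ 2, κ]) := by
  have hsys := hρ.solvesSystem hσ hκ
  have hcont := (hasFDerivAt_g hsys.ratio_eq.1.ne' (ratio_image_mem hκ hsys)).continuousAt
  filter_upwards [hρ.ae_tendsto_sampleMoment hindep hlaw] with ω hω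
  rw [← g_popMoment hκ hsys]
  exact hcont.tendsto.comp hω

lemma IsNMLLaw.ae_eventually_wellDefined (hσ : 0 < σ) (hκ : κ ∈ Set.Ioo (0 : ℝ) 1)
    (hρ : IsNMLLaw μ σ κ ρ) (hindep : iIndepFun Y P) (hlaw : ∀ i, HasLaw (Y i) ρ P) :
    ∀ᵐ ω ∂P, ∀ᶠ n in atTop,
      sampleMoment (fun i => Y i ω) n 1 ^ 2 < sampleMoment (fun i => Y i ω) n 2 ∧
      sampleRatio (fun i => Y i ω) n ∈ h '' Set.Ioc 0 1 := by
  have hsys := hρ.solvesSystem hσ hκ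
  obtain ⟨hlt, hr⟩ := hsys.ratio_eq
  filter_upwards [hρ.ae_tendsto_sampleMoment hindep hlaw] with ω hω
  have h1 := ((hasFDerivAt_coord 0 _).continuousAt.tendsto.comp hω).pow 2
  have h2 := (hasFDerivAt_coord 1 _).continuousAt.tendsto.comp hω
  have h3 := (hasFDerivAt_ratio hlt.ne').continuousAt.tendsto.comp hω
  -- Here `κ < 1` matters: the range of `h` is a neighbourhood of `h κ`, so the sample ratios
  -- eventually enter it.
  have hmem : h '' Set.Ioc 0 1 ∈
      𝓝 (ratio (popMoment ρ 1) (popMoment ρ 2) (popMoment ρ 4)) := by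
    rw [hr]
    exact mem_of_superset (image_h_Ioo_mem_nhds hκ) (Set.image_mono Set.Ioo_subset_Ioc_self)
  filter_upwards [h1.eventually_lt h2 hlt, h3.eventually_mem hmem] with n hn1 hn2
  exact ⟨hn1, hn2⟩

lemma IsNMLLaw.posSemidef_asympCov (hκ : 0 < κ) (hρ : IsNMLLaw μ σ κ ρ) :
    (asympCov μ σ κ ρ).PosSemidef := by
  simpa [asympCov] using (hρ.posSemidef_covMatrix hκ).mul_mul_conjTranspose_same
    (gradG (popMoment ρ 1) (popMoment ρ 2) (popMoment ρ 4))

lemma IsNMLLaw.tendstoInDistribution_sampleMoment (hκ : 0 < κ)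
    (hρ : IsNMLLaw μ σ κ ρ) (hindep : iIndepFun Y P) (hlaw : ∀ i, HasLaw (Y i) ρ P) :
    TendstoInDistribution
      (fun (n : ℕ) ω => √(n : ℝ) • (!₂[sampleMoment (fun i => Y i ω) n 1,
        sampleMoment (fun i => Y i ω) n 2, sampleMoment (fun i => Y i ω) n 4] -
        !₂[popMoment ρ 1, popMoment ρ 2, popMoment ρ 4]))
      atTop id (fun _ => P) (multivariateGaussian 0 (covMatrix μ σ κ)) := by
  have hvar (t : EuclideanSpace ℝ (Fin 3)) : Var[fun ω => inner ℝ (powVec (Y 0 ω)) t; P] =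
      t.ofLp ⬝ᵥ (covMatrix μ σ κ).mulVec t.ofLp := by
    have hm : Measurable fun y => inner ℝ (powVec y) t := measurable_powVec.inner_const
    rw [← hρ.variance_inner_powVec hκ t, ← (hlaw 0).map_eq,
      variance_map hm.aemeasurable (hlaw 0).aemeasurable]
    rfl
  have hclt := tendstoInDistribution_multivariate_clt (V := fun i ω => powVec (Y i ω))
    (hρ.posSemidef_covMatrix hκ) (hρ.memLp_powVec_comp hlaw)
    (hindep.comp (fun _ => powVec) fun _ => measurable_powVec) (identDistrib_powVec hlaw) hvar
  rw [hρ.integral_powVec_comp hlaw] at hclt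
  convert hclt using 3 with n ω
  rename_i ω
  rw [sampleMoment_eq]
  -- For `n = 0` both normalisations, `√0` and `(√0)⁻¹`, are zero. For `n > 0` the two scalings
  -- agree because `√n = n / √n`.
  rcases Nat.eq_zero_or_pos n with rfl | hn
  · simp
  · have hn' : (0 : ℝ) < n := by exact_mod_cast hn
    have hs : √(n : ℝ) = (√(n : ℝ))⁻¹ * n := by
      rw [inv_mul_eq_div, Real.div_sqrt]
    have hsmul (v : EuclideanSpace ℝ (Fin 3)) : √(n : ℝ) • v = (√(n : ℝ))⁻¹ • (n : ℝ) • v := by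
      rw [smul_smul, ← hs]
    rw [hsmul, smul_sub, smul_smul (n : ℝ), mul_inv_cancel₀ hn'.ne', one_smul]

lemma IsNMLLaw.tendstoInDistribution_estimators (hσ : 0 < σ) (hκ : κ ∈ Set.Ioo (0 : ℝ) 1)
    (hρ : IsNMLLaw μ σ κ ρ) (hindep : iIndepFun Y P) (hlaw : ∀ i, HasLaw (Y i) ρ P) :
    TendstoInDistribution
      (fun (n : ℕ) (ω : Ω) =>
        √(n : ℝ) • (!₂[muHat (fun i => Y i ω) n, sigmaSqHat (fun i => Y i ω) n,
          kappaHat (fun i => Y i ω) n] - !₂[μ, σ ^ 2, κ]))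
      atTop id (fun _ => P) (multivariateGaussian 0 (asympCov μ σ κ ρ)) := by
  have hsys := hρ.solvesSystem hσ hκ
  have hmeas (n : ℕ) : AEMeasurable (fun ω => !₂[sampleMoment (fun i => Y i ω) n 1,
      sampleMoment (fun i => Y i ω) n 2, sampleMoment (fun i => Y i ω) n 4]) P := by
    simp only [sampleMoment_eq]
    exact (Finset.aemeasurable_fun_sum (Finset.range n) fun i _ =>
      measurable_powVec.comp_aemeasurable (hlaw i).aemeasurable).fun_const_smul _
  have hdelta := tendstoInDistribution_delta_method (fun n : ℕ => Real.sqrt_nonneg n) hmeas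
    (hρ.ae_tendsto_sampleMoment hindep hlaw)
    (hρ.tendstoInDistribution_sampleMoment hκ.1 hindep hlaw) measurable_g
    (hasFDerivAt_g hsys.ratio_eq.1.ne' (ratio_image_mem hκ hsys))
  simp only [g_popMoment hκ hsys, g_sampleMoment] at hdelta
  refine ⟨hdelta.forall_aemeasurable, aemeasurable_id, ?_⟩
  have hlim := hdelta.tendsto
  simp only [id] at hlim
  simpa only [map_toEuclideanCLM_multivariateGaussian (hρ.posSemidef_covMatrix hκ.1),
    Measure.map_id, asympCov] using hlim

end Sample

end NML

theorem proposition3 :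
    -- `h` is continuous and strictly decreasing on `(0, 1]`, so that its inverse makes sense
    (ContinuousOn NML.h (Set.Ioc 0 1) ∧ StrictAntiOn NML.h (Set.Ioc 0 1)) ∧
    -- the explicit formulas give the unique solution of the method-of-moments system
    (∀ x y z : ℝ, x ^ 2 < y → NML.ratio x y z ∈ NML.h '' Set.Ioc 0 1 →
      ∀ m s k : ℝ, NML.SolvesSystem x y z m s k ↔
        !₂[m, s, k] = NML.g !₂[x, y, z]) ∧
    -- `gradG` is the Jacobian matrix of `g`
    (∀ x y z : ℝ, y ≠ x ^ 2 → NML.ratio x y z ∈ NML.h '' Set.Ioo 0 1 →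
      HasFDerivAt NML.g (Matrix.toEuclideanCLM (𝕜 := ℝ) (NML.gradG x y z)) !₂[x, y, z]) ∧
    ∀ (μ σ κ : ℝ), 0 < σ → κ ∈ Set.Ioo (0 : ℝ) 1 →
    ∀ (ρ : Measure ℝ), NML.IsNMLLaw μ σ κ ρ →
      -- all moments of the law are finite, the moments of order 1, 2, 4 are as in the system,
      -- and `Σ` is the covariance matrix of `(Y, Y², Y⁴)`
      (∀ k : ℕ, Integrable (fun x : ℝ => x ^ k) ρ) ∧
      NML.SolvesSystem (NML.popMoment ρ 1) (NML.popMoment ρ 2) (NML.popMoment ρ 4) μ (σ ^ 2) κ ∧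
      (∀ i j : Fin 3, NML.covMatrix μ σ κ i j =
        covariance (fun x : ℝ => x ^ (![1, 2, 4] i : ℕ)) (fun x : ℝ => x ^ (![1, 2, 4] j : ℕ)) ρ) ∧
      ∀ {Ω : Type*} [MeasurableSpace Ω] (P : Measure Ω) [IsProbabilityMeasure P] (Y : ℕ → Ω → ℝ),
        iIndepFun Y P → (∀ i, HasLaw (Y i) ρ P) →
        -- almost surely the estimators are well defined for all large sample sizes
        (∀ᵐ ω ∂P, ∀ᶠ n in atTop,
          NML.sampleMoment (fun i => Y i ω) n 1 ^ 2 < NML.sampleMoment (fun i => Y i ω) n 2 ∧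
          NML.sampleRatio (fun i => Y i ω) n ∈ NML.h '' Set.Ioc 0 1) ∧
        -- strong consistency
        (∀ᵐ ω ∂P, Tendsto (fun n => NML.muHat (fun i => Y i ω) n) atTop (𝓝 μ)) ∧
        (∀ᵐ ω ∂P, Tendsto (fun n => NML.sigmaSqHat (fun i => Y i ω) n) atTop (𝓝 (σ ^ 2))) ∧
        (∀ᵐ ω ∂P, Tendsto (fun n => NML.kappaHat (fun i => Y i ω) n) atTop (𝓝 κ)) ∧
        -- asymptotic normality
        (NML.asympCov μ σ κ ρ).PosSemidef ∧
        TendstoInDistribution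
          (fun (n : ℕ) (ω : Ω) =>
            √(n : ℝ) • (!₂[NML.muHat (fun i => Y i ω) n, NML.sigmaSqHat (fun i => Y i ω) n,
              NML.kappaHat (fun i => Y i ω) n] - !₂[μ, σ ^ 2, κ]))
          atTop id (fun _ => P) (multivariateGaussian 0 (NML.asympCov μ σ κ ρ)) := by
  refine ⟨⟨NML.continuousOn_h.mono Set.Ioc_subset_Ioi_self, NML.strictAntiOn_h_Ioc⟩,
    fun x y z hxy hr m s k => NML.solvesSystem_iff hxy hr m s k,
    fun x y z hD hr => NML.hasFDerivAt_g hD hr, fun μ σ κ hσ hκ ρ hρ => ?_⟩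
  refine ⟨hρ.integrable_pow, hρ.solvesSystem hσ hκ, hρ.covMatrix_eq_covariance hκ.1, ?_⟩
  intro Ω _ P _ Y hindep hlaw
  have hlim := hρ.ae_tendsto_estimators hσ hκ hindep hlaw
  refine ⟨hρ.ae_eventually_wellDefined hσ hκ hindep hlaw, ?_, ?_, ?_,
    hρ.posSemidef_asympCov hκ.1, hρ.tendstoInDistribution_estimators hσ hκ hindep hlaw⟩
  · filter_upwards [hlim] with ω hω
    exact (NML.hasFDerivAt_coord 0 _).continuousAt.tendsto.comp hω
  · filter_upwards [hlim] with ω hω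
    exact (NML.hasFDerivAt_coord 1 _).continuousAt.tendsto.comp hω
  · filter_upwards [hlim] with ω hω
    exact (NML.hasFDerivAt_coord 2 _).continuousAt.tendsto.comp hω
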